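/- Let $Q\subset\mathbb{R}^d$ be a (convex) polytope. A *facial orientation* of $Q$ is an acyclic orientation $\mathcal{O}$ of the 1-skeleton of $Q$ whose restriction to each nonempty face of $Q$ (including $Q$) has a unique source and a unique sink. Say that $Q$ is *$\mathcal{O}$-directionally simple* if, for every vertex $v$ of $Q$, every set $E$ of edges outgoing from $v$ spans a face $F_E$ (the smallest face containing $v$ and $E$) of dimension $|E|$, and distinct sets $E$ span distinct faces. Let $\mathcal{O}$ be a facial orientation of $Q$ such that $Q$ is $\mathcal{O}$-directionally simple, and suppose that $\mathcal{O}$ is the Hasse diagram of a lattice $L$ on the vertex set of $Q$. Let $u\le_L v$, and let $a$ be the number of atoms of the interval $[u,v]_L$. Let $\mathcal{M}(u,v)$ be the graph whose vertices are the saturated chains of $L$ from $u$ to $v$, two chains being adjacent if they differ by a single move across a 2-face: that is, for some 2-dimensional face $F$ of $Q$, both chains contain the source and the sink of $F$, they agree below the source and above the sink of $F$, and between the source and the sink they follow the two different sides of $F$. Then $\mathcal{M}(u,v)$ is connected. If moreover $a\ge 2$, then $\mathcal{M}(u,v)$ is $(a-1)$-connected: it has more than $a-1$ vertices, and it remains connected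 after the deletion of any set of at most $a-2$ vertices. -/

import Mathlib

/-! ## Polytopes, faces and the 1-skeleton -/

section Polytope

variable {E : Type*} [AddCommGroup E] [Module ℝ E]

/-- A (convex) polytope: the convex hull of finitely many points. -/
def IsPolytope (Q : Set E) : Prop :=
  ∃ S : Finset E, Q = convexHull ℝ (S : Set E)

/-- The nonempty faces of a convex set `Q` (`Q` itself included): the nonempty convex subsets `F`
such that a segment of `Q` having a relative interior point in `F` lies in `F`. For a polytope these
are the nonempty intersections with supporting hyperplanes, together with `Q`. -/
def IsFace (Q F : Set E) : Prop :=
  F.Nonempty ∧ Convex ℝ F ∧ IsExtreme ℝ Q F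

/-- The (affine) dimension of a nonempty set. -/
noncomputable def faceDim (F : Set E) : ℕ :=
  Module.finrank ℝ (vectorSpan ℝ F)

/-- The type of vertices of `Q`. It is a type of its own, so that it carries no
order inherited from the ambient space. -/
def Vertex (Q : Set E) : Type _ := {x : E // x ∈ Q.extremePoints ℝ}

/-- The 1-skeleton of `Q`: two distinct vertices are adjacent when the segment between them is a
face (an edge) of `Q`. -/
def skeleton (Q : Set E) : SimpleGraph (Vertex Q) where
  Adj x y := x ≠ y ∧ IsFace Q (segment ℝ x.1 y.1)
  symm := ⟨fun x y h => ⟨h.1.symm, by rw [segment_symm]; exact h.2⟩⟩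
  loopless := ⟨fun _ h => h.1 rfl⟩

/-! ## Orientations of the 1-skeleton -/

/-- `s` is a source of the restriction to the face `F` of the orientation `O`.
Here `O x y` means that there is an edge between `x` and `y`, oriented from `x` to `y`. -/
def IsSourceOf {Q : Set E} (O : Vertex Q → Vertex Q → Prop) (F : Set E) (s : Vertex Q) : Prop :=
  s.1 ∈ F ∧ ∀ x : Vertex Q, x.1 ∈ F → ¬ O x s

/-- `t` is a sink of the restriction to the face `F` of the orientation `O`. -/
def IsSinkOf {Q : Set E} (O : Vertex Q → Vertex Q → Prop) (F : Set E) (t : Vertex Q) : Prop :=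
  t.1 ∈ F ∧ ∀ x : Vertex Q, x.1 ∈ F → ¬ O t x

/-- A facial orientation: an acyclic orientation of the 1-skeleton of `Q` whose restriction to each
face of `Q` has a unique source and a unique sink. -/
structure IsFacialOrientation (Q : Set E) (O : Vertex Q → Vertex Q → Prop) : Prop where
  adj_iff : ∀ x y, (skeleton Q).Adj x y ↔ O x y ∨ O y x
  acyclic : ∀ x, ¬ Relation.TransGen O x x
  source : ∀ F, IsFace Q F → ∃! s, IsSourceOf O F s
  sink : ∀ F, IsFace Q F → ∃! t, IsSinkOf O F t

/-- `F` is the face spanned by the edges joining `v` to the elements of `A`: the smallest face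
containing `v` and these edges. (A face contains an edge as soon as it contains its endpoints.) -/
def SpansFace (Q : Set E) (v : Vertex Q) (A : Set (Vertex Q)) (F : Set E) : Prop :=
  IsLeast {G : Set E | IsFace Q G ∧ v.1 ∈ G ∧ ∀ w ∈ A, w.1 ∈ G} F

/-- `Q` is `O`-directionally simple: at each vertex `v`, each set of edges outgoing from `v`, given
by the set `A` of their other endpoints, spans a face of dimension `|A|`, and distinct such
sets span distinct faces. -/
def IsDirectionallySimple (Q : Set E) (O : Vertex Q → Vertex Q → Prop) : Prop :=
  ∀ (v : Vertex Q) (A : Set (Vertex Q)), (∀ w ∈ A, O v w) →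
    ∃ F : Set E, SpansFace Q v A F ∧ faceDim F = A.ncard ∧
      ∀ B : Set (Vertex Q), (∀ w ∈ B, O v w) → SpansFace Q v B F → B = A

end Polytope

/-! ## Saturated chains and moves -/

/-- A saturated chain from `u` to `v` in a poset, as the list of its elements in increasing order:
each element is covered by the next one, the first is `u` and the last is `v`. -/
@[ext]
structure SaturatedChain {P : Type*} [PartialOrder P] (u v : P) where
  verts : List P
  isChain : verts.IsChain (· ⋖ ·)
  head_eq : verts.head? = some u
  last_eq : verts.getLast? = some v

/-- `p` is a list of vertices of the face `F` that begins at a source of `F` and ends at a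
sink of `F`. -/
def TraversesFace {E : Type*} [AddCommGroup E] [Module ℝ E] {Q : Set E}
    (O : Vertex Q → Vertex Q → Prop) (F : Set E) (p : List (Vertex Q)) : Prop :=
  (∀ x ∈ p, x.1 ∈ F) ∧ (∃ s, IsSourceOf O F s ∧ p.head? = some s) ∧
    ∃ t, IsSinkOf O F t ∧ p.getLast? = some t

/-- The chains `c` and `c'` differ by a single move across a 2-face: there is a 2-dimensional face
`F` through which both run from the source of `F` to the sink of `F`, along different sides, and
outside of which they agree. -/
def IsMove {E : Type*} [AddCommGroup E] [Module ℝ E] {Q : Set E} [PartialOrder (Vertex Q)]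
    (O : Vertex Q → Vertex Q → Prop) {u v : Vertex Q} (c c' : SaturatedChain u v) : Prop :=
  ∃ (F : Set E) (l p p' r : List (Vertex Q)), IsFace Q F ∧ faceDim F = 2 ∧
    c.verts = l ++ p ++ r ∧ c'.verts = l ++ p' ++ r ∧ p ≠ p' ∧
    TraversesFace O F p ∧ TraversesFace O F p'

/-- The move graph `M(u, v)`: its vertices are the saturated chains from `u` to `v`, its edges
connect the pairs of chains that differ by a single move across a 2-face of `Q`. -/
def moveGraph {E : Type*} [AddCommGroup E] [Module ℝ E] {Q : Set E} [PartialOrder (Vertex Q)]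
    (O : Vertex Q → Vertex Q → Prop) (u v : Vertex Q) : SimpleGraph (SaturatedChain u v) where
  Adj c c' := IsMove O c c'
  symm := ⟨fun _ _ ⟨F, l, p, p', r, hF, hd, h, h', hne, hp, hp'⟩ =>
    ⟨F, l, p', p, r, hF, hd, h', h, hne.symm, hp', hp⟩⟩
  loopless := ⟨fun _ ⟨_, _, _, _, _, _, _, h, h', hne, _, _⟩ => hne (by
    have h2 := h.symm.trans h'
    simpa using h2)⟩

/-- The number of atoms of the interval `[u, v]`. -/
noncomputable def numAtoms {P : Type*} [PartialOrder P] (u v : P) : ℕ :=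
  {x : P | u ⋖ x ∧ x ≤ v}.ncard

/-- A graph is `k`-connected (in the sense of vertex connectivity) if it has more than `k` vertices
and remains connected after the deletion of any set of fewer than `k` vertices. -/
def IsKConnected {W : Type*} (G : SimpleGraph W) (k : ℕ) : Prop :=
  (k : ℕ∞) < ENat.card W ∧ ∀ S : Finset W, S.card < k → (G.induce (S : Set W)ᶜ).Connected

/-!
Only the 2-faces matter. Their vertex sets form an `IsPolygonFamily` in the lattice: two upper
covers of an element lie with it in a 2-face, each 2-face has a unique sink, a vertex has at most
two neighbours in a 2-face, and two 2-faces share at most two vertices.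

The lattice property enters through `IsPolygonFamily.sinkIsJoin`: the sink of the 2-face spanned by
two upper covers `y`, `z` of `x` is `y ⊔ z`. By downward induction on `x`, each side of the 2-face
from `y` or `z` to the sink is an interval (`IsPolygonFamily.mem_of_le_sink`). If `y ⊔ z` were not
the sink it would lie on both sides, and its lower covers on the two sides would have to coincide,
giving a smaller upper bound of `y` and `z`. As a consequence, the chains through two atoms of
`[x, v]` are always joined by a move, and if `[x, v]` has `a` atoms and `i` is one of them, then
`[i, v]` has at least `a - 1` atoms, one on the 2-face through `i` and `k` for each atom `k ≠ i`.

Connectivity is proved by downward induction on the lower end `x` of the interval. Delete at most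
`a - 2` chains and choose an atom `j` none of whose chains is deleted; every chain should be
connected to one through `j`. The chains through another atom `i` remain connected by induction,
unless all deleted chains pass through `i`. In the first case there are `a - 1` disjoint routes to
`j`, directly or by way of a third atom, and some route is free. In the second case one has to leave
the chains through `i` by a move that changes the atom, although they may have become disconnected.
So a second statement is carried through the induction (`ExitsReachable`): given an edge `w ⋖ x`
and 2-faces through it that contain more atoms of `[x, v]` than there are deleted chains, every
remaining chain from `x` to `v` is connected to one that follows such a 2-face up to its sink. Both
statements reduce to `IsPolygonFamily.exists_reachable_follows`, in which `w` is any neighbour of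
`x`: a lower one for the second statement, the atom `j` for the first.
-/

/-! ### Polygon families in a finite lattice -/

section PolygonFamily

variable {P : Type*}

/-- `s` is a source of `F`: it covers no element of `F`. -/
def IsPolygonSource [PartialOrder P] (F : Set P) (s : P) : Prop :=
  s ∈ F ∧ ∀ x ∈ F, ¬ x ⋖ s

/-- `t` is a sink of `F`: no element of `F` covers it. -/
def IsPolygonSink [PartialOrder P] (F : Set P) (t : P) : Prop :=
  t ∈ F ∧ ∀ x ∈ F, ¬ t ⋖ x

/-- `x` and `y` are joined by an edge of the Hasse diagram. -/
def HasseAdj [PartialOrder P] (x y : P) : Prop := x ⋖ y ∨ y ⋖ x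

/-- The properties of the vertex sets of the 2-faces that the combinatorial argument uses: two
upper covers of the same element lie with it in a polygon, a polygon has a unique sink, an element
of a polygon has at most two neighbours in it, and distinct polygons share at most two elements. -/
structure IsPolygonFamily [PartialOrder P] (𝓕 : Set (Set P)) : Prop where
  exists_mem : ∀ {x y z : P}, x ⋖ y → x ⋖ z → y ≠ z → ∃ F ∈ 𝓕, x ∈ F ∧ y ∈ F ∧ z ∈ F
  existsUnique_sink : ∀ {F : Set P}, F ∈ 𝓕 → ∃! t, IsPolygonSink F t
  not_three : ∀ {F : Set P}, F ∈ 𝓕 → ∀ {x a b c : P}, x ∈ F → a ∈ F → b ∈ F → c ∈ F →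
    HasseAdj x a → HasseAdj x b → HasseAdj x c → a ≠ b → a ≠ c → b ≠ c → False
  eq_of_three : ∀ {F G : Set P}, F ∈ 𝓕 → G ∈ 𝓕 → ∀ {x y z : P}, x ∈ F → y ∈ F → z ∈ F →
    x ∈ G → y ∈ G → z ∈ G → x ≠ y → x ≠ z → y ≠ z → F = G

theorem exists_covBy_of_ne_sink [PartialOrder P] {F : Set P} {x : P} (hx : x ∈ F)
    (hs : ¬ IsPolygonSink F x) : ∃ y ∈ F, x ⋖ y := by
  by_contra hcon
  push Not at hcon
  exact hs ⟨hx, hcon⟩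

theorem covBy_not_le [PartialOrder P] {x y z : P} (hxy : x ⋖ y) (hxz : x ⋖ z) (hyz : y ≠ z) :
    ¬ y ≤ z :=
  fun hle => hxz.2 hxy.lt (lt_of_le_of_ne hle hyz)

variable [Lattice P] [Finite P] {𝓕 : Set (Set P)}

omit [Finite P] in
/-- An element with two upper covers in a polygon is a source of it. -/
theorem IsPolygonFamily.isSource (h : IsPolygonFamily 𝓕) {F : Set P} (hF : F ∈ 𝓕) {x y z : P}
    (hx : x ∈ F) (hy : y ∈ F) (hz : z ∈ F) (hxy : x ⋖ y) (hxz : x ⋖ z) (hyz : y ≠ z) :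
    IsPolygonSource F x := by
  refine ⟨hx, fun w hw hwx => ?_⟩
  exact h.not_three hF hx hw hy hz (.inr hwx) (.inl hxy) (.inl hxz)
    (hwx.lt.trans hxy.lt).ne (hwx.lt.trans hxz.lt).ne hyz

theorem IsPolygonFamily.le_sink (h : IsPolygonFamily 𝓕) {F : Set P} (hF : F ∈ 𝓕) {t x : P}
    (ht : IsPolygonSink F t) (hx : x ∈ F) : x ≤ t := by
  induction x using WellFoundedGT.induction with
  | _ x ih =>
    by_cases hs : IsPolygonSink F x
    · exact ((h.existsUnique_sink hF).unique hs ht).le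
    · obtain ⟨y, hy, hxy⟩ := exists_covBy_of_ne_sink hx hs
      exact hxy.le.trans (ih y hxy.lt hy)

/-- The sink of `F` lies below every common upper bound of two upper covers in `F` of `x`. -/
def SinkIsJoin (𝓕 : Set (Set P)) (x : P) : Prop :=
  ∀ F ∈ 𝓕, ∀ {y z t v : P}, x ∈ F → y ∈ F → z ∈ F → x ⋖ y → x ⋖ z → y ≠ z →
    IsPolygonSink F t → y ≤ v → z ≤ v → t ≤ v

/-- Every element between a non-source `b` of a polygon and the sink `t` lies in the polygon.
Otherwise some `w ≤ t` covers an element `b` of a side without being on the side. The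
polygon spanned by `w` and the next element `b'` of the side has its sink below `t`, so it leaves
the side at `b'` in the same way; induction along the side gives a contradiction at `t`. -/
theorem IsPolygonFamily.mem_of_le_sink (h : IsPolygonFamily 𝓕) {F : Set P} (hF : F ∈ 𝓕) {t : P}
    (ht : IsPolygonSink F t) {a b m : P} (hJ : ∀ x, a < x → SinkIsJoin 𝓕 x)
    (ha : a ∈ F) (hb : b ∈ F) (hab : a ⋖ b) (hbm : b ≤ m) (hmt : m ≤ t) : m ∈ F := by
  induction b using WellFoundedGT.induction generalizing a m with
  | _ b ih =>
    rcases hbm.eq_or_lt with rfl | hbm'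
    · exact hb
    obtain ⟨w, hbw, hwm⟩ := hbm'.exists_covby_le
    have hJ' : ∀ x, b < x → SinkIsJoin 𝓕 x := fun x hx => hJ x (hab.lt.trans hx)
    suffices hw : w ∈ F from ih w hbw.lt hJ' hb hw hbw hwm hmt
    by_contra hwF
    have hbt : ¬ IsPolygonSink F b := fun hs => by
      have := (h.existsUnique_sink hF).unique hs ht
      subst this
      exact (hbm'.trans_le hmt).false
    obtain ⟨b', hb', hbb'⟩ := exists_covBy_of_ne_sink hb hbt
    have hne : b' ≠ w := by rintro rfl; exact hwF hb'
    obtain ⟨K, hK, hbK, hb'K, hwK⟩ := h.exists_mem hbb' hbw hne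
    obtain ⟨k, hk, -⟩ := h.existsUnique_sink hK
    have hkt : k ≤ t := hJ b hab.lt K hK hbK hb'K hwK hbb' hbw hne hk (h.le_sink hF ht hb')
      (hwm.trans hmt)
    have hb'k : ¬ IsPolygonSink K b' := fun hs =>
      covBy_not_le hbw hbb' hne.symm (h.le_sink hK hs hwK)
    obtain ⟨c, hc, hb'c⟩ := exists_covBy_of_ne_sink hb'K hb'k
    have hcF : c ∈ F := ih b' hbb'.lt hJ' hb hb' hbb' hb'c.le ((h.le_sink hK hk hc).trans hkt)
    have : F = K := h.eq_of_three hF hK hb hb' hcF hbK hb'K hc hbb'.lt.ne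
      (hbb'.lt.trans hb'c.lt).ne hb'c.lt.ne
    exact hwF (this ▸ hwK)

/-- In a lattice, the sink of a polygon is the join of the two upper covers of its source. -/
theorem IsPolygonFamily.sinkIsJoin (h : IsPolygonFamily 𝓕) (x : P) : SinkIsJoin 𝓕 x := by
  induction x using WellFoundedGT.induction with
  | _ x ih =>
    intro F hF y z t v hx hy hz hxy hxz hyz ht hyv hzv
    suffices y ⊔ z = t from this ▸ sup_le hyv hzv
    have hmt : y ⊔ z ≤ t := sup_le (h.le_sink hF ht hy) (h.le_sink hF ht hz)
    have hym : y < y ⊔ z := left_lt_sup.2 (covBy_not_le hxz hxy hyz.symm)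
    have hzm : z < y ⊔ z := right_lt_sup.2 (covBy_not_le hxy hxz hyz)
    obtain ⟨p, hyp, hpm⟩ := hym.exists_le_covby
    obtain ⟨q, hzq, hqm⟩ := hzm.exists_le_covby
    have hm := h.mem_of_le_sink hF ht ih hx hy hxy hym.le hmt
    have hp := h.mem_of_le_sink hF ht ih hx hy hxy hyp (hpm.le.trans hmt)
    have hq := h.mem_of_le_sink hF ht ih hx hz hxz hzq (hqm.le.trans hmt)
    by_contra hne
    have hms : ¬ IsPolygonSink F (y ⊔ z) := fun hs => hne ((h.existsUnique_sink hF).unique hs ht)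
    obtain ⟨c, hc, hmc⟩ := exists_covBy_of_ne_sink hm hms
    have hpq : p ≠ q := by
      rintro rfl
      exact (hpm.lt.trans_le (sup_le hyp hzq)).false
    exact h.not_three hF hm hp hq hc (.inr hpm) (.inr hqm) (.inl hmc) hpq
      (hpm.lt.trans hmc.lt).ne (hqm.lt.trans hmc.lt).ne

omit [Finite P] in
/-- The polygon through an edge `x ⋖ i` and another neighbour `k` of `x` continues beyond `i`
by an element `r` that determines `k`. -/
theorem IsPolygonFamily.neighbor_unique (h : IsPolygonFamily 𝓕) {F G : Set P} (hF : F ∈ 𝓕)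
    (hG : G ∈ 𝓕) {x i r k k' : P} (hxi : x ⋖ i) (hir : i ⋖ r) (hFx : x ∈ F) (hFi : i ∈ F)
    (hFr : r ∈ F) (hFk : k ∈ F) (hGx : x ∈ G) (hGi : i ∈ G) (hGr : r ∈ G) (hGk : k' ∈ G)
    (hk : HasseAdj x k) (hk' : HasseAdj x k') (hki : k ≠ i) (hki' : k' ≠ i) : k = k' := by
  obtain rfl := h.eq_of_three hF hG hFx hFi hFr hGx hGi hGr hxi.lt.ne (hxi.lt.trans hir.lt).ne
    hir.lt.ne
  by_contra hne
  exact h.not_three hF hFx hFi hFk hGk (.inl hxi) hk hk' hki.symm hki'.symm hne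

end PolygonFamily

/-! ### Saturated chains as lists -/

section Chains

variable {P : Type*}

/-- `l` is the list of elements of a saturated chain from `u` to `v`. -/
def IsSat [PartialOrder P] (u v : P) (l : List P) : Prop :=
  l.IsChain (· ⋖ ·) ∧ l.head? = some u ∧ l.getLast? = some v

section PartialOrder

variable [PartialOrder P] {u v x y t : P} {l p r : List P}

theorem isSat_singleton (x : P) : IsSat x x [x] := ⟨.singleton x, rfl, rfl⟩

theorem IsSat.exists_eq_cons (h : IsSat x v l) : ∃ l', l = x :: l' := by
  cases l with
  | nil => simp [IsSat] at h
  | cons a l => exact ⟨l, by rw [Option.some.inj h.2.1]⟩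

theorem isSat_cons_cons : IsSat x v (x :: y :: l) ↔ x ⋖ y ∧ IsSat y v (y :: l) := by
  simp [IsSat, and_assoc]

theorem IsSat.cons (hxy : x ⋖ y) (h : IsSat y v l) : IsSat x v (x :: l) := by
  obtain ⟨l', rfl⟩ := h.exists_eq_cons
  exact isSat_cons_cons.2 ⟨hxy, h⟩

theorem IsSat.cases (h : IsSat x v l) :
    (l = [x] ∧ x = v) ∨ ∃ y l', l = x :: l' ∧ x ⋖ y ∧ IsSat y v l' := by
  obtain ⟨l', rfl⟩ := h.exists_eq_cons
  cases l' with
  | nil => exact .inl ⟨rfl, by simpa [IsSat] using h⟩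
  | cons y l' =>
    obtain ⟨hxy, hy⟩ := isSat_cons_cons.1 h
    exact .inr ⟨y, y :: l', rfl, hxy, hy⟩

theorem IsSat.le (h : IsSat x v l) : x ≤ v := by
  induction l generalizing x with
  | nil => simp [IsSat] at h
  | cons a l ih =>
    rcases h.cases with ⟨-, h⟩ | ⟨y, l', heq, hxy, hy⟩
    · exact h.le
    · obtain ⟨-, rfl⟩ := List.cons.inj heq
      exact hxy.le.trans (ih hy)

theorem IsSat.append (hp : IsSat x t p) (hr : IsSat t v (t :: r)) : IsSat x v (p ++ r) := by
  induction p generalizing x with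
  | nil => simp [IsSat] at hp
  | cons a p ih =>
    rcases hp.cases with ⟨heq, rfl⟩ | ⟨y, l', heq, hxy, hy⟩
    · rw [heq]; exact hr
    · obtain ⟨rfl, rfl⟩ := List.cons.inj heq
      exact (ih hy).cons hxy

theorem IsSat.of_append (hp : IsSat x t p) (h : IsSat x v (p ++ r)) : IsSat t v (t :: r) := by
  induction p generalizing x with
  | nil => simp [IsSat] at hp
  | cons a p ih =>
    rcases hp.cases with ⟨heq, rfl⟩ | ⟨y, l', heq, hxy, hy⟩
    · rw [heq] at h; exact h
    · obtain ⟨rfl, rfl⟩ := List.cons.inj heq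
      obtain ⟨l'', rfl⟩ := hy.exists_eq_cons
      exact ih hy (isSat_cons_cons.1 h).2

theorem exists_isSat [Finite P] (h : x ≤ v) : ∃ l, IsSat x v l := by
  induction x using WellFoundedGT.induction with
  | _ x ih =>
    rcases h.eq_or_lt with rfl | hlt
    · exact ⟨[x], isSat_singleton x⟩
    · obtain ⟨y, hxy, hy⟩ := hlt.exists_covby_le
      obtain ⟨l, hl⟩ := ih y hxy.lt hy
      exact ⟨x :: l, hl.cons hxy⟩

end PartialOrder

/-- The list `p` stays in `F` and runs from a source to a sink of `F`. -/
def TraversesPolygon [PartialOrder P] (F : Set P) (p : List P) : Prop :=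
  (∀ x ∈ p, x ∈ F) ∧ (∃ s, IsPolygonSource F s ∧ p.head? = some s) ∧
    ∃ t, IsPolygonSink F t ∧ p.getLast? = some t

/-- The lists `a` and `b` differ by replacing one side of a polygon of `𝓕` by another one. -/
def PolygonMove [PartialOrder P] (𝓕 : Set (Set P)) (a b : List P) : Prop :=
  ∃ F ∈ 𝓕, ∃ l p p' r : List P, a = l ++ p ++ r ∧ b = l ++ p' ++ r ∧ p ≠ p' ∧
    TraversesPolygon F p ∧ TraversesPolygon F p'

theorem PolygonMove.symm [PartialOrder P] {𝓕 : Set (Set P)} {a b : List P}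
    (h : PolygonMove 𝓕 a b) : PolygonMove 𝓕 b a := by
  obtain ⟨F, hF, l, p, p', r, ha, hb, hne, hp, hp'⟩ := h
  exact ⟨F, hF, l, p', p, r, hb, ha, hne.symm, hp', hp⟩

theorem PolygonMove.cons [PartialOrder P] {𝓕 : Set (Set P)} {a b : List P} (x : P)
    (h : PolygonMove 𝓕 a b) : PolygonMove 𝓕 (x :: a) (x :: b) := by
  obtain ⟨F, hF, l, p, p', r, rfl, rfl, hne, hp, hp'⟩ := h
  exact ⟨F, hF, x :: l, p, p', r, rfl, rfl, hne, hp, hp'⟩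

/-- The graph of moves between the saturated chains from `u` to `v` that are not in `S`. The other
lists are isolated vertices, so only its connected components that contain a chain matter. -/
def chainGraph [PartialOrder P] (𝓕 : Set (Set P)) (u v : P) (S : Finset (List P)) :
    SimpleGraph (List P) where
  Adj a b := PolygonMove 𝓕 a b ∧ (IsSat u v a ∧ a ∉ S) ∧ (IsSat u v b ∧ b ∉ S)
  symm := ⟨fun _ _ h => ⟨h.1.symm, h.2.2, h.2.1⟩⟩
  loopless := ⟨fun _ h => by
    obtain ⟨F, -, l, p, p', r, ha, hb, hne, -, -⟩ := h.1
    have h2 := ha.symm.trans hb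
    exact hne (by simpa using h2)⟩

open Classical in
/-- The chains through `y` obtained by removing the first element `x` from those members of `S` that
begin with `x, y`. -/
noncomputable def chainsVia (S : Finset (List P)) (x y : P) : Finset (List P) :=
  (S.filter fun l => [x, y] <+: l).image List.tail

theorem card_chainsVia_le (S : Finset (List P)) (x y : P) :
    (chainsVia S x y).card ≤ S.card := by
  classical
  unfold chainsVia
  exact Finset.card_image_le.trans (Finset.card_filter_le _ _)

theorem prefix_of_card_le_chainsVia {S : Finset (List P)} {x y : P}
    (h : S.card ≤ (chainsVia S x y).card) {l : List P} (hl : l ∈ S) : [x, y] <+: l := by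
  classical
  unfold chainsVia at h
  have h1 := Finset.eq_of_subset_of_card_le (Finset.filter_subset (fun l => [x, y] <+: l) S)
    (h.trans Finset.card_image_le)
  rw [← h1] at hl
  exact (Finset.mem_filter.1 hl).2

theorem chainsVia_eq_empty {S : Finset (List P)} {x y : P} (h : ∀ l ∈ S, ¬ [x, y] <+: l) :
    chainsVia S x y = ∅ := by
  classical
  rw [chainsVia, Finset.image_eq_empty, Finset.filter_eq_empty_iff]
  exact fun l hl => h l hl

theorem mem_chainsVia [PartialOrder P] {S : Finset (List P)} {x y v : P} {l : List P}
    (hl : IsSat y v l) : l ∈ chainsVia S x y ↔ x :: l ∈ S := by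
  classical
  obtain ⟨l', rfl⟩ := hl.exists_eq_cons
  simp only [chainsVia, Finset.mem_image, Finset.mem_filter]
  constructor
  · rintro ⟨m, ⟨hm, s, rfl⟩, h⟩
    simp only [List.cons_append, List.nil_append, List.tail_cons] at h
    rw [← h]
    exact hm
  · exact fun h => ⟨_, ⟨h, l', rfl⟩, rfl⟩

theorem reachable_cons [PartialOrder P] {𝓕 : Set (Set P)} {x y v : P} {S : Finset (List P)}
    {a b : List P} (hxy : x ⋖ y) (h : (chainGraph 𝓕 y v (chainsVia S x y)).Reachable a b) :
    (chainGraph 𝓕 x v S).Reachable (x :: a) (x :: b) := by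
  let f : chainGraph 𝓕 y v (chainsVia S x y) →g chainGraph 𝓕 x v S :=
    { toFun := List.cons x
      map_rel' := fun {a b} h => ⟨h.1.cons x,
        ⟨h.2.1.1.cons hxy, fun hS => h.2.1.2 ((mem_chainsVia h.2.1.1).2 hS)⟩,
        ⟨h.2.2.1.cons hxy, fun hS => h.2.2.2 ((mem_chainsVia h.2.2.1).2 hS)⟩⟩ }
  exact h.map f

/-- The chain `l` starts at `x` by running inside `G` up to a sink of `G`. -/
def Follows [PartialOrder P] (G : Set P) (x : P) (l : List P) : Prop :=
  ∃ p r t, l = p ++ r ∧ IsSat x t p ∧ (∀ z ∈ p, z ∈ G) ∧ IsPolygonSink G t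

theorem Follows.cons [PartialOrder P] {G : Set P} {x y : P} {l : List P} (h : Follows G y l)
    (hx : x ∈ G) (hxy : x ⋖ y) : Follows G x (x :: l) := by
  obtain ⟨p, r, t, rfl, hp, hpG, ht⟩ := h
  refine ⟨x :: p, r, t, rfl, hp.cons hxy, ?_, ht⟩
  simpa using ⟨hx, hpG⟩

variable [Lattice P] [Finite P] {𝓕 : Set (Set P)}

theorem IsPolygonFamily.exists_path (h : IsPolygonFamily 𝓕) {F : Set P} (hF : F ∈ 𝓕) {t x : P}
    (ht : IsPolygonSink F t) (hx : x ∈ F) : ∃ p, IsSat x t p ∧ ∀ z ∈ p, z ∈ F := by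
  induction x using WellFoundedGT.induction with
  | _ x ih =>
    by_cases hs : IsPolygonSink F x
    · obtain rfl := (h.existsUnique_sink hF).unique hs ht
      exact ⟨[x], isSat_singleton x, by simpa using hx⟩
    · obtain ⟨y, hy, hxy⟩ := exists_covBy_of_ne_sink hx hs
      obtain ⟨p, hp, hpF⟩ := ih y hxy.lt hy
      exact ⟨x :: p, hp.cons hxy, by simpa using ⟨hx, hpF⟩⟩

theorem IsPolygonFamily.exists_follows (h : IsPolygonFamily 𝓕) {G : Set P} (hG : G ∈ 𝓕)
    {t x v : P} (ht : IsPolygonSink G t) (htv : t ≤ v) (hx : x ∈ G) :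
    ∃ l, IsSat x v l ∧ Follows G x l := by
  obtain ⟨p, hp, hpG⟩ := h.exists_path hG ht hx
  obtain ⟨l, hl⟩ := exists_isSat htv
  obtain ⟨r, rfl⟩ := hl.exists_eq_cons
  exact ⟨p ++ r, hp.append hl, p, r, t, rfl, hp, hpG, ht⟩

/-- A chain that starts along one side of a polygon can be moved to the other side. -/
theorem IsPolygonFamily.exists_move (h : IsPolygonFamily 𝓕) {F : Set P} (hF : F ∈ 𝓕)
    {x i k v : P} (hx : x ∈ F) (hi : i ∈ F) (hk : k ∈ F) (hxi : x ⋖ i) (hxk : x ⋖ k) (hik : i ≠ k)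
    {l : List P} (hl : IsSat i v l) (hfol : Follows F i l) :
    ∃ l', IsSat k v l' ∧ PolygonMove 𝓕 (x :: l) (x :: l') := by
  obtain ⟨p, r, t, rfl, hp, hpF, ht⟩ := hfol
  obtain ⟨q, hq, hqF⟩ := h.exists_path hF ht hk
  have hs := h.isSource hF hx hi hk hxi hxk hik
  refine ⟨q ++ r, hq.append (hp.of_append hl), F, hF, [], x :: p, x :: q, r, rfl, rfl, ?_,
    ⟨by simpa using ⟨hx, hpF⟩, ⟨x, hs, rfl⟩, t, ht, (hp.cons hxi).2.2⟩,
    ⟨by simpa using ⟨hx, hqF⟩, ⟨x, hs, rfl⟩, t, ht, (hq.cons hxk).2.2⟩⟩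
  rintro heq
  have h1 := hp.2.1
  rw [List.cons.inj heq |>.2, hq.2.1] at h1
  exact hik (Option.some.inj h1).symm

/-- The polygon through `x ⋖ i` and the neighbour `k` of `x` has its sink below `v`, and `i ⋖ r`
is an edge of it. -/
def IsSide (𝓕 : Set (Set P)) (v x i k r : P) : Prop :=
  HasseAdj x k ∧ k ≠ i ∧ i ⋖ r ∧
    ∃ F ∈ 𝓕, x ∈ F ∧ i ∈ F ∧ k ∈ F ∧ r ∈ F ∧ ∃ t, IsPolygonSink F t ∧ t ≤ v

omit [Finite P] in
theorem IsPolygonFamily.isSide_unique (h : IsPolygonFamily 𝓕) {v x i k k' r : P} (hxi : x ⋖ i)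
    (hk : IsSide 𝓕 v x i k r) (hk' : IsSide 𝓕 v x i k' r) : k = k' := by
  obtain ⟨ha, hki, hir, F, hF, hFx, hFi, hFk, hFr, -⟩ := hk
  obtain ⟨ha', hki', -, G, hG, hGx, hGi, hGk, hGr, -⟩ := hk'
  exact h.neighbor_unique hF hG hxi hir hFx hFi hFr hFk hGx hGi hGr hGk ha ha' hki hki'

/-- Distinct neighbours `k` of `x` give distinct upper covers of `i`. -/
theorem IsPolygonFamily.ncard_le_of_isSide (h : IsPolygonFamily 𝓕) {v x i : P} (hxi : x ⋖ i)
    {K T : Set P} (hK : ∀ k ∈ K, ∃ r ∈ T, IsSide 𝓕 v x i k r) : K.ncard ≤ T.ncard := by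
  choose! f hf using hK
  refine Set.ncard_le_ncard_of_injOn f (fun k hk => (hf k hk).1) ?_ (Set.toFinite T)
  intro k hk k' hk' heq
  have h1 := (hf k hk).2
  rw [heq] at h1
  exact h.isSide_unique hxi h1 (hf k' hk').2

/-- Two upper covers of `x` below `v` are joined by a move across the polygon they span. -/
theorem IsPolygonFamily.exists_link (h : IsPolygonFamily 𝓕) {x i k v : P} (hxi : x ⋖ i)
    (hxk : x ⋖ k) (hik : i ≠ k) (hiv : i ≤ v) (hkv : k ≤ v) :
    ∃ l l' r, IsSat i v l ∧ IsSat k v l' ∧ PolygonMove 𝓕 (x :: l) (x :: l') ∧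
      IsSide 𝓕 v x i k r ∧ [x, i, r] <+: x :: l := by
  obtain ⟨F, hF, hx, hi, hk⟩ := h.exists_mem hxi hxk hik
  obtain ⟨t, ht, -⟩ := h.existsUnique_sink hF
  have htv : t ≤ v := h.sinkIsJoin x F hF hx hi hk hxi hxk hik ht hiv hkv
  have hsi : ¬ IsPolygonSink F i := fun hs =>
    covBy_not_le hxk hxi hik.symm (h.le_sink hF hs hk)
  obtain ⟨r, hr, hir⟩ := exists_covBy_of_ne_sink hi hsi
  obtain ⟨l, hl, hfol⟩ := h.exists_follows hF ht htv hr
  obtain ⟨l', hl', hmove⟩ := h.exists_move hF hx hi hk hxi hxk hik (hl.cons hir) (hfol.cons hi hir)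
  obtain ⟨m, rfl⟩ := hl.exists_eq_cons
  exact ⟨_, l', r, hl.cons hir, hl', hmove,
    ⟨.inl hxk, hik.symm, hir, F, hF, hx, hi, hk, hr, t, ht, htv⟩, ⟨m, rfl⟩⟩

omit [Lattice P] [Finite P] in
/-- If each member of `S` meets at most one of more than `|S|` classes, some class is free. -/
theorem exists_forall_not_of_card_lt {α β : Type*} {K : Set α} {S : Finset β} {R : α → β → Prop}
    (hR : ∀ k ∈ K, ∀ k' ∈ K, ∀ s, R k s → R k' s → k = k') (hK : S.card < K.ncard) :
    ∃ k ∈ K, ∀ s ∈ S, ¬ R k s := by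
  by_contra! hcon
  choose f hf using fun k : K => hcon k k.2
  refine hK.not_ge ?_
  have hinj : Function.Injective fun k : K => (⟨f k, (hf k).1⟩ : S) := by
    intro k k' heq
    have h1 := (hf k).2
    rw [show f k = f k' from congrArg Subtype.val heq] at h1
    exact Subtype.ext (hR k k.2 k' k'.2 _ h1 (hf k').2)
  simpa using Nat.card_le_card_of_injective _ hinj

end Chains

/-! ### Connectivity of the graph of moves -/

section Connectivity

variable {P : Type*}

theorem IsSat.prefix_iff [PartialOrder P] {x y k v : P} {l : List P} (hl : IsSat y v l) :
    [x, k] <+: x :: l ↔ k = y := by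
  obtain ⟨l', rfl⟩ := hl.exists_eq_cons
  simp [List.cons_prefix_cons]

theorem Follows.tail [PartialOrder P] {G : Set P} {x y z v : P} {l : List P}
    (h : Follows G x (x :: l)) (hl : IsSat y v l) (hz : z ∈ G) (hxz : x ⋖ z) :
    y ∈ G ∧ Follows G y l := by
  obtain ⟨p, r, t, heq, hp, hpG, ht⟩ := h
  rcases hp.cases with ⟨-, rfl⟩ | ⟨y', p', rfl, -, hy'⟩
  · exact absurd hxz (ht.2 z hz)
  · obtain rfl : l = p' ++ r := (List.cons.inj heq).2
    obtain ⟨p'', rfl⟩ := hy'.exists_eq_cons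
    have : y' = y := by simpa using hl.2.1
    subst this
    exact ⟨hpG _ (by simp), y' :: p'', r, t, rfl, hy', fun z hz => hpG z (by simp_all), ht⟩

variable [Lattice P] [Finite P] {𝓕 : Set (Set P)}

/-- Deleting at most `a - 2` chains from `x` to `v`, where `a` is the number of atoms of `[x, v]`,
leaves the others connected by moves. For `a ≤ 1` the truncated difference is `0`. -/
def ChainsConnected (𝓕 : Set (Set P)) (v x : P) : Prop :=
  ∀ S : Finset (List P), S.card ≤ numAtoms x v - 2 → ∀ a b, IsSat x v a → IsSat x v b →
    a ∉ S → b ∉ S → (chainGraph 𝓕 x v S).Reachable a b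

/-- Fix `w ⋖ x` and a collection `𝓖` of polygons through this edge. If fewer chains are deleted
than there are atoms `q` of `[x, v]` in polygons of `𝓖`, then every remaining chain from `x` to `v`
is connected to one that starts along a side of a polygon of `𝓖`. Such a chain, preceded by `w`, can
be moved across that polygon when `w` is its source. -/
def ExitsReachable (𝓕 : Set (Set P)) (v x : P) : Prop :=
  ∀ w, w ⋖ x → ∀ 𝓖 ⊆ 𝓕, (∀ G ∈ 𝓖, w ∈ G ∧ x ∈ G ∧ ∃ t, IsPolygonSink G t ∧ t ≤ v) →
    ∀ S : Finset (List P), S.card < {q | x ⋖ q ∧ ∃ G ∈ 𝓖, q ∈ G}.ncard →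
      ∀ c, IsSat x v c → c ∉ S → ∃ c', IsSat x v c' ∧ c' ∉ S ∧
        (chainGraph 𝓕 x v S).Reachable c c' ∧ ∃ G ∈ 𝓖, Follows G x c'

omit [Finite P] in
/-- All chains through `x` and its upper cover `k` are connected if none of them is deleted. -/
theorem ChainsConnected.reachable_cons_of_free {v x k : P} (hk : ChainsConnected 𝓕 v k)
    (hxk : x ⋖ k) {S : Finset (List P)} (hfree : ∀ s ∈ S, ¬ [x, k] <+: s) {a b : List P}
    (ha : IsSat k v a) (hb : IsSat k v b) :
    (chainGraph 𝓕 x v S).Reachable (x :: a) (x :: b) := by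
  refine reachable_cons hxk ?_
  rw [chainsVia_eq_empty hfree]
  exact hk ∅ (by simp) a b ha hb (by simp) (by simp)

omit [Finite P] in
theorem notMem_of_free {v x k : P} {S : Finset (List P)} (hfree : ∀ s ∈ S, ¬ [x, k] <+: s)
    {a : List P} (ha : IsSat k v a) : x :: a ∉ S :=
  fun h => hfree _ h (ha.prefix_iff.2 rfl)

/-- Let `w` be a neighbour of `x` such that each atom `q ≠ w` of `[x, v]` lies in a polygon of `𝓖`,
a collection of polygons through `x` and `w`. If fewer chains are deleted than there are such atoms,
then every remaining chain not through `w` is connected to one that follows a polygon of `𝓖`.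

Let the given chain pass through the atom `i`. If the polygon of `𝓖` through `i` ends at `i`, nothing
is to be done. Otherwise the neighbours `k ≠ i` of `x` (the atoms, and `w`) give distinct atoms of
`[i, v]`. Hence, unless all deleted chains pass through `i`, the remaining chains through `i` are
connected, and they lead to `𝓖` directly or by way of some atom `k`: the deleted chains are too few
to block all these disjoint routes. If all deleted chains pass through `i`, then `ExitsReachable` at
`i` yields a chain that follows `𝓖`, or that can be moved to one through another atom. -/
theorem IsPolygonFamily.exists_reachable_follows (h : IsPolygonFamily 𝓕) {x v w : P}
    (hw : HasseAdj x w) (ih₁ : ∀ y, x < y → ChainsConnected 𝓕 v y)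
    (ih₂ : ∀ y, x < y → ExitsReachable 𝓕 v y) {𝓖 : Set (Set P)} (h𝓖 : 𝓖 ⊆ 𝓕)
    (hmem : ∀ G ∈ 𝓖, w ∈ G ∧ x ∈ G ∧ ∃ t, IsPolygonSink G t ∧ t ≤ v)
    (hA : ∀ q, x ⋖ q → q ≤ v → q ≠ w → ∃ G ∈ 𝓖, q ∈ G) {S : Finset (List P)}
    (hS : S.card < ({q | x ⋖ q ∧ q ≤ v} \ {w}).ncard) {c : List P} (hc : IsSat x v c)
    (hcS : c ∉ S) (hcw : ¬ [x, w] <+: c) :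
    ∃ c', IsSat x v c' ∧ c' ∉ S ∧ (chainGraph 𝓕 x v S).Reachable c c' ∧
      ∃ G ∈ 𝓖, Follows G x c' := by
  set A : Set P := {q | x ⋖ q ∧ q ≤ v} with hAdef
  -- an atom `k` whose chains are all present leads to a polygon of `𝓖`
  have finish : ∀ k, x ⋖ k → k ≤ v → k ≠ w → (∀ s ∈ S, ¬ [x, k] <+: s) → ∀ l, IsSat k v l →
      ∃ c', IsSat x v c' ∧ c' ∉ S ∧ (chainGraph 𝓕 x v S).Reachable (x :: l) c' ∧
        ∃ G ∈ 𝓖, Follows G x c' := by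
    intro k hxk hkv hkw hfree l hl
    obtain ⟨G, hG, hkG⟩ := hA k hxk hkv hkw
    obtain ⟨-, hxG, t, ht, htv⟩ := hmem G hG
    obtain ⟨l', hl', hfol⟩ := h.exists_follows (h𝓖 hG) ht htv hkG
    exact ⟨x :: l', hl'.cons hxk, notMem_of_free hfree hl',
      (ih₁ k hxk.lt).reachable_cons_of_free hxk hfree hl hl', G, hG, hfol.cons hxG hxk⟩
  rcases hc.cases with ⟨-, rfl⟩ | ⟨i, l, rfl, hxi, hl⟩
  · obtain ⟨q, ⟨hxq, hqx⟩, -⟩ := Set.nonempty_of_ncard_ne_zero (Nat.ne_zero_of_lt hS)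
    exact absurd hxq.lt hqx.not_gt
  have hiw : i ≠ w := fun hiw => hcw (hl.prefix_iff.2 hiw.symm)
  obtain ⟨G, hG, hiG⟩ := hA i hxi hl.le hiw
  obtain ⟨hwG, hxG, t, ht, htv⟩ := hmem G hG
  by_cases hsink : IsPolygonSink G i
  · obtain ⟨l', rfl⟩ := hl.exists_eq_cons
    exact ⟨_, hc, hcS, .refl _, G, hG,
      Follows.cons ⟨[i], l', i, rfl, isSat_singleton i, by simpa using hiG, hsink⟩ hxG hxi⟩
  obtain ⟨r₀, hr₀G, hir₀⟩ := exists_covBy_of_ne_sink hiG hsink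
  have hside₀ : IsSide 𝓕 v x i w r₀ :=
    ⟨hw, hiw.symm, hir₀, G, h𝓖 hG, hxG, hiG, hwG, hr₀G, t, ht, htv⟩
  -- the neighbours of `x` other than `i` that are used, and the polygons through them
  set N : Set P := insert w ((A \ {w}) \ {i}) with hN
  have hNcard : N.ncard = (A \ {w}).ncard := by
    rw [hN, Set.ncard_insert_of_notMem (fun h => h.1.2 rfl) (Set.toFinite _),
      Set.ncard_sdiff_singleton_add_one (show i ∈ A \ {w} from ⟨⟨hxi, hl.le⟩, hiw⟩) (Set.toFinite _)]
  set 𝓖' : Set (Set P) := {F | F ∈ 𝓕 ∧ x ∈ F ∧ i ∈ F ∧ (∃ t, IsPolygonSink F t ∧ t ≤ v) ∧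
    (F ∈ 𝓖 ∨ ∃ k, x ⋖ k ∧ k ≠ i ∧ k ≠ w ∧ k ∈ F)} with h𝓖'
  set T : Set P := {r | i ⋖ r ∧ ∃ F ∈ 𝓖', r ∈ F} with hT
  have hside : ∀ k ∈ N, ∃ r ∈ T, IsSide 𝓕 v x i k r := by
    rintro k (rfl | ⟨⟨⟨hxk, hkv⟩, hkw⟩, hki⟩)
    · exact ⟨r₀, ⟨hir₀, G, ⟨h𝓖 hG, hxG, hiG, ⟨t, ht, htv⟩, .inl hG⟩, hr₀G⟩, hside₀⟩
    · obtain ⟨-, -, r, -, -, -, hs, -⟩ := h.exists_link hxi hxk (Ne.symm hki) hl.le hkv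
      obtain ⟨-, -, hir, F, hF, hFx, hFi, hFk, hFr, hFt⟩ := id hs
      exact ⟨r, ⟨hir, F, ⟨hF, hFx, hFi, hFt, .inr ⟨k, hxk, hki, hkw, hFk⟩⟩, hFr⟩, hs⟩
  have hNT : N.ncard ≤ T.ncard := h.ncard_le_of_isSide hxi hside
  have hTA : T.ncard ≤ numAtoms i v := by
    refine Set.ncard_le_ncard ?_ (Set.toFinite _)
    rintro r ⟨hir, F, ⟨hF, -, -, ⟨t, ht, htv⟩, -⟩, hrF⟩
    exact ⟨hir, (h.le_sink hF ht hrF).trans htv⟩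
  by_cases hsmall : (chainsVia S x i).card ≤ numAtoms i v - 2
  · have conn : ∀ l', IsSat i v l' → x :: l' ∉ S →
        (chainGraph 𝓕 x v S).Reachable (x :: l) (x :: l') := fun l' hl' hl'S =>
      reachable_cons hxi (ih₁ i hxi.lt _ hsmall _ _ hl hl' (fun hm => hcS ((mem_chainsVia hl).1 hm))
        (fun hm => hl'S ((mem_chainsVia hl').1 hm)))
    -- the route belonging to `k` uses chains through `x, i, r`, with `r` on the side of `k`,
    -- and chains through `x, k`
    obtain ⟨k, hk, hfree⟩ := exists_forall_not_of_card_lt (K := N) (S := S)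
      (R := fun k s => (∃ r, [x, i, r] <+: s ∧ IsSide 𝓕 v x i k r) ∨ (k ≠ w ∧ [x, k] <+: s)) (by
        have hNi : ∀ k ∈ N, k ≠ i := by
          rintro k (rfl | ⟨-, hki⟩)
          exacts [hiw.symm, hki]
        rintro k hk k' hk' _ (⟨r, ⟨m, rfl⟩, hs⟩ | ⟨-, ⟨m, rfl⟩⟩) (⟨r', hp', hs'⟩ | ⟨-, hp'⟩)
        · obtain rfl : r' = r := by simpa [List.cons_prefix_cons] using hp'
          exact h.isSide_unique hxi hs hs'
        · exact absurd (by simpa [List.cons_prefix_cons] using hp') (hNi k' hk')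
        · rw [List.cons_append, List.cons_prefix_cons] at hp'
          exact absurd (List.cons_prefix_cons.1 hp'.2).1.symm (hNi k hk)
        · simpa [List.cons_prefix_cons, eq_comm] using hp') (hNcard ▸ hS)
    rcases hk with rfl | ⟨⟨⟨hxk, hkv⟩, hkw⟩, hki⟩
    · obtain ⟨m, hm, hfol⟩ := h.exists_follows (h𝓖 hG) ht htv hr₀G
      have hmS : x :: i :: m ∉ S := fun hmem => hfree _ hmem (.inl ⟨r₀, by
        obtain ⟨m', rfl⟩ := hm.exists_eq_cons
        exact ⟨m', rfl⟩, hside₀⟩)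
      exact ⟨_, (hm.cons hir₀).cons hxi, hmS, conn _ (hm.cons hir₀) hmS, G, hG,
        (hfol.cons hiG hir₀).cons hxG hxi⟩
    · have hkfree : ∀ s ∈ S, ¬ [x, k] <+: s := fun s hs hp => hfree s hs (.inr ⟨hkw, hp⟩)
      obtain ⟨l₁, l₂, r, hl₁, hl₂, hmove, hs, hp⟩ :=
        h.exists_link hxi hxk (Ne.symm hki) hl.le hkv
      have hl₁S : x :: l₁ ∉ S := fun hmem => hfree _ hmem (.inl ⟨r, hp, hs⟩)
      obtain ⟨c', hc', hc'S, hreach, hfol⟩ := finish k hxk hkv hkw hkfree l₂ hl₂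
      have hadj : (chainGraph 𝓕 x v S).Adj (x :: l₁) (x :: l₂) :=
        ⟨hmove, ⟨hl₁.cons hxi, hl₁S⟩, hl₂.cons hxk, notMem_of_free hkfree hl₂⟩
      exact ⟨c', hc', hc'S, ((conn _ hl₁ hl₁S).trans hadj.reachable).trans hreach, hfol⟩
  · have hle := card_chainsVia_le S x i
    have hall : ∀ s ∈ S, [x, i] <+: s := fun s hs =>
      prefix_of_card_le_chainsVia (by omega) hs
    obtain ⟨c', hc', hc'S, hreach, F, ⟨hF, hxF, hiF, -, hor⟩, hfol⟩ :=
      ih₂ i hxi.lt x hxi 𝓖' (fun F hF => hF.1) (fun F hF => ⟨hF.2.1, hF.2.2.1, hF.2.2.2.1⟩)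
        (chainsVia S x i) (show _ < T.ncard by omega) l hl (fun hm => hcS ((mem_chainsVia hl).1 hm))
    have hreach' := reachable_cons hxi hreach
    have hc'S' : x :: c' ∉ S := fun hm => hc'S ((mem_chainsVia hc').2 hm)
    rcases hor with hFG | ⟨k, hxk, hki, hkw, hkF⟩
    · exact ⟨_, hc'.cons hxi, hc'S', hreach', F, hFG, hfol.cons hxF hxi⟩
    · have hkfree : ∀ s ∈ S, ¬ [x, k] <+: s := by
        rintro s hs hp
        obtain ⟨m, rfl⟩ := hall s hs
        exact hki (by simpa [List.cons_prefix_cons] using hp)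
      obtain ⟨l₂, hl₂, hmove⟩ := h.exists_move hF hxF hiF hkF hxi hxk hki.symm hc' hfol
      obtain ⟨c'', hc'', hc''S, hreach'', hfol''⟩ := finish k hxk hl₂.le hkw hkfree l₂ hl₂
      have hadj : (chainGraph 𝓕 x v S).Adj (x :: c') (x :: l₂) :=
        ⟨hmove, ⟨hc'.cons hxi, hc'S'⟩, hl₂.cons hxk, notMem_of_free hkfree hl₂⟩
      exact ⟨c'', hc'', hc''S, (hreach'.trans hadj.reachable).trans hreach'', hfol''⟩

/-- Some atom `j` has none of its chains deleted, and every chain is connected to one through `j`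
by following a polygon that contains `j`. -/
theorem IsPolygonFamily.chainsConnected_of_lt (h : IsPolygonFamily 𝓕) {x v : P}
    (ih₁ : ∀ y, x < y → ChainsConnected 𝓕 v y) (ih₂ : ∀ y, x < y → ExitsReachable 𝓕 v y) :
    ChainsConnected 𝓕 v x := by
  intro S hS a b ha hb haS hbS
  set A : Set P := {q | x ⋖ q ∧ q ≤ v} with hA
  change S.card ≤ A.ncard - 2 at hS
  rcases A.eq_empty_or_nonempty with hemp | hne
  · have honly : ∀ c, IsSat x v c → c = [x] := by
      intro c hc
      rcases hc.cases with ⟨h, -⟩ | ⟨i, l, -, hxi, hl⟩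
      · exact h
      · have : i ∈ A := ⟨hxi, hl.le⟩
        simp [hemp] at this
    rw [honly a ha, honly b hb]
  have hpos : 0 < A.ncard := (Set.ncard_pos (Set.toFinite A)).2 hne
  obtain ⟨j, ⟨hxj, hjv⟩, hjfree⟩ := exists_forall_not_of_card_lt (K := A) (S := S)
    (R := fun k s => [x, k] <+: s) (by
      rintro k - k' - _ ⟨m, rfl⟩ hp
      simpa [List.cons_prefix_cons, eq_comm] using hp) (by omega)
  have key : ∀ c, IsSat x v c → c ∉ S →
      ∃ l, IsSat j v l ∧ (chainGraph 𝓕 x v S).Reachable c (x :: l) := by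
    intro c hc hcS
    have through : ∀ c, IsSat x v c → [x, j] <+: c → ∃ l, IsSat j v l ∧ c = x :: l := by
      rintro c hc ⟨m, rfl⟩
      exact ⟨j :: m, (isSat_cons_cons.1 hc).2, rfl⟩
    by_cases hcj : [x, j] <+: c
    · obtain ⟨l, hl, rfl⟩ := through c hc hcj
      exact ⟨l, hl, .refl _⟩
    have hcard : S.card < (A \ {j}).ncard := by
      rcases hc.cases with ⟨-, rfl⟩ | ⟨i, l, rfl, hxi, hl⟩
      · exact absurd hxj.lt hjv.not_gt
      have hij : i ∈ A \ {j} := ⟨⟨hxi, hl.le⟩, fun hij => hcj (hl.prefix_iff.2 (Eq.symm hij))⟩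
      have h1 := Set.ncard_sdiff_singleton_add_one (show j ∈ A from ⟨hxj, hjv⟩) (Set.toFinite A)
      have h2 : 0 < (A \ {j}).ncard := (Set.ncard_pos (Set.toFinite _)).2 ⟨i, hij⟩
      omega
    obtain ⟨c', hc', hc'S, hreach, F, ⟨hF, hxF, hjF, -⟩, hfol⟩ :=
      h.exists_reachable_follows (w := j) (.inl hxj) ih₁ ih₂
        (𝓖 := {F | F ∈ 𝓕 ∧ x ∈ F ∧ j ∈ F ∧ ∃ t, IsPolygonSink F t ∧ t ≤ v})
        (fun F hF => hF.1) (fun F hF => ⟨hF.2.2.1, hF.2.1, hF.2.2.2⟩)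
        (by
          intro q hxq hqv hqj
          obtain ⟨F, hF, hxF, hqF, hjF⟩ := h.exists_mem hxq hxj hqj
          obtain ⟨t, ht, -⟩ := h.existsUnique_sink hF
          exact ⟨F, ⟨hF, hxF, hjF, t, ht, h.sinkIsJoin x F hF hxF hqF hjF hxq hxj hqj ht hqv hjv⟩,
            hqF⟩) hcard hc hcS hcj
    by_cases hc'j : [x, j] <+: c'
    · obtain ⟨l, hl, rfl⟩ := through c' hc' hc'j
      exact ⟨l, hl, hreach⟩
    rcases hc'.cases with ⟨-, rfl⟩ | ⟨i, l, rfl, hxi, hl⟩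
    · exact absurd hxj.lt hjv.not_gt
    obtain ⟨hiF, hfol'⟩ := hfol.tail hl hjF hxj
    obtain ⟨l₂, hl₂, hmove⟩ := h.exists_move hF hxF hiF hjF hxi hxj
      (fun hij => hc'j (hl.prefix_iff.2 hij.symm)) hl hfol'
    have hadj : (chainGraph 𝓕 x v S).Adj (x :: l) (x :: l₂) :=
      ⟨hmove, ⟨hc', hc'S⟩, hl₂.cons hxj, notMem_of_free hjfree hl₂⟩
    exact ⟨l₂, hl₂, hreach.trans hadj.reachable⟩
  obtain ⟨la, hla, hra⟩ := key a ha haS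
  obtain ⟨lb, hlb, hrb⟩ := key b hb hbS
  exact (hra.trans ((ih₁ j hxj.lt).reachable_cons_of_free hxj hjfree hla hlb)).trans hrb.symm

/-- If some atom of `[x, v]` is in no polygon of `𝓖`, then few enough chains are deleted for the
remaining ones to be connected, and one of them follows a polygon of `𝓖`. -/
theorem IsPolygonFamily.exitsReachable_of_lt (h : IsPolygonFamily 𝓕) {x v : P}
    (hx : ChainsConnected 𝓕 v x) (ih₁ : ∀ y, x < y → ChainsConnected 𝓕 v y)
    (ih₂ : ∀ y, x < y → ExitsReachable 𝓕 v y) : ExitsReachable 𝓕 v x := by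
  intro w hwx 𝓖 h𝓖 hmem S hS c hc hcS
  set A : Set P := {q | x ⋖ q ∧ q ≤ v} with hA
  have hsub : {q | x ⋖ q ∧ ∃ G ∈ 𝓖, q ∈ G} ⊆ A := by
    rintro q ⟨hxq, G, hG, hq⟩
    obtain ⟨-, -, t, ht, htv⟩ := hmem G hG
    exact ⟨hxq, (h.le_sink (h𝓖 hG) ht hq).trans htv⟩
  by_cases hall : ∀ q ∈ A, ∃ G ∈ 𝓖, q ∈ G
  · have hwA : A \ {w} = A := Set.sdiff_singleton_eq_self fun hw => (hw.1.lt.trans hwx.lt).false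
    refine h.exists_reachable_follows (.inr hwx) ih₁ ih₂ h𝓖 hmem
      (fun q hxq hqv _ => hall q ⟨hxq, hqv⟩) ?_ hc hcS ?_
    · rw [← hA, hwA]
      exact hS.trans_le (Set.ncard_le_ncard hsub (Set.toFinite _))
    · rintro ⟨m, rfl⟩
      exact ((isSat_cons_cons.1 hc).1.lt.trans hwx.lt).false
  · push Not at hall
    obtain ⟨q, hqA, hq⟩ := hall
    have hlt : {q | x ⋖ q ∧ ∃ G ∈ 𝓖, q ∈ G}.ncard < A.ncard :=
      Set.ncard_lt_ncard ⟨hsub, fun hle => by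
        obtain ⟨-, G, hG, hqG⟩ := hle hqA
        exact hq G hG hqG⟩ (Set.toFinite _)
    obtain ⟨k, ⟨hxk, G, hG, hkG⟩, hkfree⟩ := exists_forall_not_of_card_lt
      (R := fun k s => [x, k] <+: s) (by
        rintro k - k' - _ ⟨m, rfl⟩ hp
        simpa [List.cons_prefix_cons, eq_comm] using hp) hS
    obtain ⟨-, hxG, t, ht, htv⟩ := hmem G hG
    obtain ⟨l, hl, hfol⟩ := h.exists_follows (h𝓖 hG) ht htv hkG
    have hlS := notMem_of_free hkfree hl
    have hS' : S.card ≤ numAtoms x v - 2 := by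
      change S.card ≤ A.ncard - 2
      omega
    exact ⟨_, hl.cons hxk, hlS, hx S hS' _ _ hc (hl.cons hxk) hcS hlS, G, hG, hfol.cons hxG hxk⟩

theorem IsPolygonFamily.chainsConnected (h : IsPolygonFamily 𝓕) (v x : P) :
    ChainsConnected 𝓕 v x := by
  suffices ChainsConnected 𝓕 v x ∧ ExitsReachable 𝓕 v x from this.1
  induction x using WellFoundedGT.induction with
  | _ x ih =>
    have hx := h.chainsConnected_of_lt (fun y hy => (ih y hy).1) (fun y hy => (ih y hy).2)
    exact ⟨hx, h.exitsReachable_of_lt hx (fun y hy => (ih y hy).1) (fun y hy => (ih y hy).2)⟩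

end Connectivity

/-! ### Two-dimensional faces -/

section Faces

variable {E : Type*} [AddCommGroup E] [Module ℝ E] {Q F G : Set E} {x y z : E}

/-- Three distinct extreme points are not collinear. -/
theorem false_of_extremePoints_collinear (hx : x ∈ Q.extremePoints ℝ)
    (hy : y ∈ Q.extremePoints ℝ) (hz : z ∈ Q.extremePoints ℝ) (hxy : x ≠ y) (hxz : x ≠ z)
    (hyz : y ≠ z) (c : ℝ) (h : y - x = c • (z - x)) : False := by
  rcases lt_trichotomy c 0 with hc | rfl | hc
  · -- `x` lies between `y` and `z`
    refine hxy.symm (hx.2 hy.1 hz.1 ⟨1 / (1 - c), -c / (1 - c), ?_, ?_, ?_, ?_⟩)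
    · exact div_pos one_pos (by linarith)
    · exact div_pos (by linarith) (by linarith)
    · rw [← add_div, ← sub_eq_add_neg]; exact div_self (by linarith)
    · have h1 : (1 - c) ≠ 0 := by linarith
      obtain rfl : y = x + c • (z - x) := by rw [← h]; abel
      match_scalars <;> field_simp <;> ring
  · exact hxy (by rw [zero_smul, sub_eq_zero] at h; exact h.symm)
  rcases lt_trichotomy c 1 with hc1 | rfl | hc1
  · refine hxy (hy.2 hx.1 hz.1 ⟨1 - c, c, by linarith, hc, by ring, ?_⟩)
    obtain rfl : y = x + c • (z - x) := by rw [← h]; abel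
    module
  · exact hyz (by simpa using h)
  · refine hxz (hz.2 hx.1 hy.1 ⟨1 - 1 / c, 1 / c, ?_, by positivity, by ring, ?_⟩)
    · rw [sub_pos, div_lt_one hc]; exact hc1
    · obtain rfl : y = x + c • (z - x) := by rw [← h]; abel
      match_scalars <;> field_simp
      ring

theorem linearIndependent_of_extremePoints (hx : x ∈ Q.extremePoints ℝ)
    (hy : y ∈ Q.extremePoints ℝ) (hz : z ∈ Q.extremePoints ℝ) (hxy : x ≠ y) (hxz : x ≠ z)
    (hyz : y ≠ z) : LinearIndependent ℝ ![y - x, z - x] := by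
  rw [LinearIndependent.pair_iff' (sub_ne_zero.2 hxy.symm)]
  intro a ha
  exact false_of_extremePoints_collinear hx hz hy hxz hxy hyz.symm a ha.symm

/-- In a set of dimension 2, three distinct extreme points are an affine frame. -/
theorem exists_coords_of_faceDim_eq_two (hF : faceDim F = 2) (hxF : x ∈ F) (hyF : y ∈ F)
    (hzF : z ∈ F) (hx : x ∈ Q.extremePoints ℝ) (hy : y ∈ Q.extremePoints ℝ)
    (hz : z ∈ Q.extremePoints ℝ) (hxy : x ≠ y) (hxz : x ≠ z) (hyz : y ≠ z) {f : E} (hf : f ∈ F) :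
    ∃ a b : ℝ, f - x = a • (y - x) + b • (z - x) := by
  have hli := linearIndependent_of_extremePoints hx hy hz hxy hxz hyz
  have hfin : FiniteDimensional ℝ (vectorSpan ℝ F) :=
    Module.finite_of_finrank_pos (by rw [show Module.finrank ℝ (vectorSpan ℝ F) = 2 from hF]; simp)
  have hle : Submodule.span ℝ (Set.range ![y - x, z - x]) ≤ vectorSpan ℝ F := by
    rw [Submodule.span_le]
    rintro _ ⟨i, rfl⟩
    fin_cases i
    · exact vsub_mem_vectorSpan ℝ hyF hxF
    · exact vsub_mem_vectorSpan ℝ hzF hxF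
  have heq := Submodule.eq_of_le_of_finrank_eq hle (by
    rw [finrank_span_eq_card hli]; exact hF.symm)
  have hmem : f - x ∈ Submodule.span ℝ (Set.range ![y - x, z - x]) :=
    heq ▸ vsub_mem_vectorSpan ℝ hf hxF
  rw [Matrix.range_cons, Matrix.range_cons, Matrix.range_empty, Set.union_empty,
    Set.singleton_union, Submodule.mem_span_pair] at hmem
  obtain ⟨a, b, h⟩ := hmem
  exact ⟨a, b, h.symm⟩

/-- A face containing three vertices of a 2-face contains the 2-face: every point of the 2-face
can be joined to a point of the triangle by a segment through the barycentre of the triangle. -/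
theorem subset_of_three_extremePoints (hF : IsFace Q F) (hF2 : faceDim F = 2) (hG : IsFace Q G)
    (hxF : x ∈ F) (hyF : y ∈ F) (hzF : z ∈ F) (hxG : x ∈ G) (hyG : y ∈ G) (hzG : z ∈ G)
    (hx : x ∈ Q.extremePoints ℝ) (hy : y ∈ Q.extremePoints ℝ)
    (hz : z ∈ Q.extremePoints ℝ) (hxy : x ≠ y) (hxz : x ≠ z) (hyz : y ≠ z) : F ⊆ G := by
  intro f hf
  obtain ⟨a, b, hab⟩ := exists_coords_of_faceDim_eq_two hF2 hxF hyF hzF hx hy hz hxy hxz hyz hf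
  obtain rfl : f = x + a • (y - x) + b • (z - x) := by rw [add_assoc, ← hab]; abel
  have htri : ∀ p q r : ℝ, 0 ≤ p → 0 ≤ q → 0 ≤ r → p + q + r = 1 →
      p • x + q • y + r • z ∈ G := by
    intro p q r hp hq hr hpqr
    have := hG.2.1.sum_mem (t := Finset.univ) (w := ![p, q, r]) (z := ![x, y, z])
      (by intro i _; fin_cases i <;> assumption) (by simp [Fin.sum_univ_three, hpqr])
      (by intro i _; fin_cases i <;> assumption)
    simpa [Fin.sum_univ_three] using this
  set N : ℝ := 1 + |a| + |b| with hN
  have hN0 : 0 < N := by positivity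
  have h1 := le_abs_self a
  have h2 := le_abs_self b
  have h3 := neg_abs_le a
  have h4 := neg_abs_le b
  set e : ℝ := 1 / (3 * N) with he
  have he0 : 0 < e := by positivity
  have heN : e * N = 1 / 3 := by rw [he]; field_simp
  have hbound : ∀ s : ℝ, s ≤ N → 0 ≤ 1 / 3 + e * (1 / 3 - s) := by
    intro s hs
    nlinarith [mul_le_mul_of_nonneg_left hs he0.le]
  -- `g` is the point beyond the barycentre, at distance `e` times that of `f`
  have hg := htri (1 / 3 + e * (1 / 3 - (1 - a - b))) (1 / 3 + e * (1 / 3 - a))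
    (1 / 3 + e * (1 / 3 - b)) (hbound _ (by linarith)) (hbound _ (by linarith))
    (hbound _ (by linarith)) (by ring)
  have hp := htri (1 / 3) (1 / 3) (1 / 3) (by norm_num) (by norm_num) (by norm_num) (by norm_num)
  refine hG.2.2.2 (hF.2.2.1 hf) (hG.2.2.1 hg) hp ⟨e / (1 + e), 1 / (1 + e), by positivity,
    by positivity, by rw [← add_div, add_comm]; exact div_self (by positivity), ?_⟩
  match_scalars <;> field_simp <;> ring

/-- An edge at `x` is not in the open cone spanned by two other edges at `x`. -/
theorem false_of_edge_mem_cone {d₁ d₂ d₃ : E} (hx : x ∈ Q) (hQ : Convex ℝ Q)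
    (h₁ : IsFace Q (segment ℝ x (x + d₁))) (h₂ : x + d₂ ∈ Q) (h₃ : x + d₃ ∈ Q)
    (hli : ∀ c : ℝ, d₂ ≠ c • d₁) {a b : ℝ} (ha : 0 < a) (hb : 0 < b)
    (h : d₁ = a • d₂ + b • d₃) : False := by
  set e : ℝ := 1 / (2 * (1 + a + b)) with he
  have he0 : 0 < e := by positivity
  have heN : e * (1 + a + b) = 1 / 2 := by rw [he]; field_simp
  have hea : 0 < e * a := by positivity
  have heb : 0 < e * b := by positivity
  have hray : ∀ (d : E) (s : ℝ), 0 ≤ s → s ≤ 1 → x + d ∈ Q → x + s • d ∈ Q := by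
    intro d s hs0 hs1 hd
    have := hQ hx hd (a := 1 - s) (b := s) (by linarith) hs0 (by ring)
    convert this using 1
    module
  have hp := hray d₂ (2 * (e * a)) (by linarith) (by nlinarith) h₂
  have hq := hray d₃ (2 * (e * b)) (by linarith) (by nlinarith) h₃
  have hm : x + e • d₁ ∈ segment ℝ x (x + d₁) :=
    ⟨1 - e, e, by nlinarith, he0.le, by ring, by module⟩
  obtain ⟨s, r, -, -, hsr, heq⟩ := h₁.2.2.2 hp hq hm
    ⟨1 / 2, 1 / 2, by norm_num, by norm_num, by norm_num, by rw [h]; module⟩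
  refine hli (r / (2 * (e * a))) ?_
  have h5 : (2 * (e * a)) • d₂ = r • d₁ := by
    have : s = 1 - r := by linarith
    subst this
    have h6 : x + (2 * (e * a)) • d₂ = x + r • d₁ := by rw [← heq]; module
    exact add_left_cancel h6
  rw [div_eq_inv_mul, mul_smul, ← h5, smul_smul, inv_mul_cancel₀ (by positivity), one_smul]

/-- A vertex of a 2-face lies on at most two edges of it. -/
theorem false_of_three_edges (hQ : Convex ℝ Q) (hF2 : faceDim F = 2) {w : E} (hxF : x ∈ F)
    (hyF : y ∈ F) (hzF : z ∈ F) (hwF : w ∈ F) (hx : x ∈ Q.extremePoints ℝ)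
    (hy : y ∈ Q.extremePoints ℝ) (hz : z ∈ Q.extremePoints ℝ) (hw : w ∈ Q.extremePoints ℝ)
    (hxy : x ≠ y) (hxz : x ≠ z) (hxw : x ≠ w) (hyz : y ≠ z) (hyw : y ≠ w) (hzw : z ≠ w)
    (ey : IsFace Q (segment ℝ x y)) (ez : IsFace Q (segment ℝ x z))
    (ew : IsFace Q (segment ℝ x w)) : False := by
  obtain ⟨a, b, hab⟩ := exists_coords_of_faceDim_eq_two hF2 hxF hyF hzF hx hy hz hxy hxz hyz hwF
  have nyz := false_of_extremePoints_collinear hx hy hz hxy hxz hyz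
  have nyw := false_of_extremePoints_collinear hx hy hw hxy hxw hyw
  have nzw := false_of_extremePoints_collinear hx hz hw hxz hxw hzw
  have nzy := false_of_extremePoints_collinear hx hz hy hxz hxy hyz.symm
  have nwy := false_of_extremePoints_collinear hx hw hy hxw hxy hyw.symm
  have nwz := false_of_extremePoints_collinear hx hw hz hxw hxz hzw.symm
  have hQy : x + (y - x) ∈ Q := by rw [add_sub_cancel]; exact hy.1
  have hQz : x + (z - x) ∈ Q := by rw [add_sub_cancel]; exact hz.1
  have hQw : x + (w - x) ∈ Q := by rw [add_sub_cancel]; exact hw.1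
  rw [← add_sub_cancel x y] at ey
  rw [← add_sub_cancel x z] at ez
  rw [← add_sub_cancel x w] at ew
  rcases lt_trichotomy a 0 with ha | rfl | ha
  · rcases lt_trichotomy b 0 with hb | rfl | hb
    · -- `x` is interior to the triangle `y z w`
      have hm : (-a / (-a - b)) • y + (-b / (-a - b)) • z ∈ Q :=
        hQ hy.1 hz.1 (div_nonneg (by linarith) (by linarith))
          (div_nonneg (by linarith) (by linarith))
          (by rw [← add_div]; exact div_self (by linarith))
      refine hxw.symm (hx.2 hw.1 hm ⟨1 / (1 - a - b), (-a - b) / (1 - a - b),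
        div_pos one_pos (by linarith), div_pos (by linarith) (by linarith),
        by rw [← add_div, div_eq_one_iff_eq (by linarith)]; ring, ?_⟩)
      obtain rfl : w = x + (a • (y - x) + b • (z - x)) := by rw [← hab]; abel
      have h1 : -a - b ≠ 0 := by linarith
      have h2 : 1 - a - b ≠ 0 := by linarith
      match_scalars <;> field_simp <;> ring
    · exact nwy a (by simpa using hab)
    · refine false_of_edge_mem_cone hx.1 hQ ez hQw hQy (fun c hc => nwz c hc)
        (a := 1 / b) (b := -a / b) (by positivity) (div_pos (by linarith) hb) ?_
      rw [hab]
      match_scalars <;> field_simp <;> ring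
  · exact nwz b (by simpa using hab)
  · rcases lt_trichotomy b 0 with hb | rfl | hb
    · refine false_of_edge_mem_cone hx.1 hQ ey hQw hQz (fun c hc => nwy c hc)
        (a := 1 / a) (b := -b / a) (by positivity) (div_pos (by linarith) ha) ?_
      rw [hab]
      match_scalars <;> field_simp <;> ring
    · exact nwy a (by simpa using hab)
    · exact false_of_edge_mem_cone hx.1 hQ ew hQy hQz (fun c hc => nyw c hc) ha hb hab

end Faces

/-! ### The 2-faces of a directionally simple polytope -/

section TwoFaces

variable {E : Type*} [AddCommGroup E] [Module ℝ E] {Q : Set E} {O : Vertex Q → Vertex Q → Prop}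

/-- The vertices of `Q` in `F`. -/
def faceVertices (Q F : Set E) : Set (Vertex Q) := {x | x.1 ∈ F}

/-- The vertex sets of the 2-faces of `Q`. -/
def polygons (Q : Set E) : Set (Set (Vertex Q)) :=
  {A | ∃ F, IsFace Q F ∧ faceDim F = 2 ∧ A = faceVertices Q F}

theorem IsPolytope.finite_vertex (hQ : IsPolytope Q) : Finite (Vertex Q) := by
  obtain ⟨S, rfl⟩ := hQ
  exact Set.Finite.to_subtype (S.finite_toSet.subset extremePoints_convexHull_subset)

variable [PartialOrder (Vertex Q)]

theorem isSinkOf_iff (hHasse : ∀ x y : Vertex Q, O x y ↔ x ⋖ y) (F : Set E) (t : Vertex Q) :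
    IsSinkOf O F t ↔ IsPolygonSink (faceVertices Q F) t := by
  simp [IsSinkOf, IsPolygonSink, faceVertices, hHasse]

theorem isSourceOf_iff (hHasse : ∀ x y : Vertex Q, O x y ↔ x ⋖ y) (F : Set E) (t : Vertex Q) :
    IsSourceOf O F t ↔ IsPolygonSource (faceVertices Q F) t := by
  simp [IsSourceOf, IsPolygonSource, faceVertices, hHasse]

theorem traversesFace_iff (hHasse : ∀ x y : Vertex Q, O x y ↔ x ⋖ y) (F : Set E)
    (p : List (Vertex Q)) : TraversesFace O F p ↔ TraversesPolygon (faceVertices Q F) p := by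
  simp only [TraversesFace, TraversesPolygon, isSourceOf_iff hHasse, isSinkOf_iff hHasse]
  rfl

/-- Of directional simplicity only the case of two outgoing edges is needed: they span a 2-face. -/
theorem isPolygonFamily_polygons (hQ : IsPolytope Q) (hO : IsFacialOrientation Q O)
    (hsimple : IsDirectionallySimple Q O) (hHasse : ∀ x y : Vertex Q, O x y ↔ x ⋖ y) :
    IsPolygonFamily (polygons Q) where
  exists_mem {x y z} hxy hxz hyz := by
    obtain ⟨F, hF, hdim, -⟩ := hsimple x {y, z} (by
      rintro w (rfl | rfl)
      exacts [(hHasse _ _).2 hxy, (hHasse _ _).2 hxz])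
    rw [Set.ncard_pair hyz] at hdim
    exact ⟨_, ⟨F, hF.1.1, hdim, rfl⟩, hF.1.2.1, hF.1.2.2 y (by simp), hF.1.2.2 z (by simp)⟩
  existsUnique_sink := by
    rintro _ ⟨F, hF, -, rfl⟩
    simpa only [isSinkOf_iff hHasse] using hO.sink F hF
  not_three := by
    rintro _ ⟨F, hF, hdim, rfl⟩ x a b c hx ha hb hc hxa hxb hxc hab hac hbc
    have hconv : Convex ℝ Q := by
      obtain ⟨S, rfl⟩ := hQ
      exact convex_convexHull ℝ _
    have hadj : ∀ {y}, HasseAdj x y → x ≠ y ∧ IsFace Q (segment ℝ x.1 y.1) := fun {y} h =>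
      (hO.adj_iff x y).2 (by simpa only [hHasse, HasseAdj] using h)
    have hne : ∀ {p q : Vertex Q}, p ≠ q → p.1 ≠ q.1 := fun h h' => h (Subtype.ext h')
    exact false_of_three_edges hconv hdim hx ha hb hc x.2 a.2 b.2 c.2 (hne (hadj hxa).1)
      (hne (hadj hxb).1) (hne (hadj hxc).1) (hne hab) (hne hac) (hne hbc) (hadj hxa).2 (hadj hxb).2
      (hadj hxc).2
  eq_of_three := by
    rintro _ _ ⟨F, hF, hF2, rfl⟩ ⟨G, hG, hG2, rfl⟩ x y z hxF hyF hzF hxG hyG hzG hxy hxz hyz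
    have hne : ∀ {p q : Vertex Q}, p ≠ q → p.1 ≠ q.1 := fun h h' => h (Subtype.ext h')
    have h1 := subset_of_three_extremePoints hF hF2 hG hxF hyF hzF hxG hyG hzG x.2 y.2 z.2 (hne hxy)
      (hne hxz) (hne hyz)
    have h2 := subset_of_three_extremePoints hG hG2 hF hxG hyG hzG hxF hyF hzF x.2 y.2 z.2 (hne hxy)
      (hne hxz) (hne hyz)
    rw [h1.antisymm h2]

theorem SaturatedChain.isSat {P : Type*} [PartialOrder P] {u v : P} (c : SaturatedChain u v) :
    IsSat u v c.verts := ⟨c.isChain, c.head_eq, c.last_eq⟩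

theorem SaturatedChain.verts_injective {P : Type*} [PartialOrder P] (u v : P) :
    Function.Injective (SaturatedChain.verts : SaturatedChain u v → List P) :=
  fun _ _ => SaturatedChain.ext

theorem isMove_of_polygonMove (hHasse : ∀ x y : Vertex Q, O x y ↔ x ⋖ y) {u v : Vertex Q}
    {c c' : SaturatedChain u v} (h : PolygonMove (polygons Q) c.verts c'.verts) :
    IsMove O c c' := by
  obtain ⟨_, ⟨F, hF, hdim, rfl⟩, l, p, p', r, ha, hb, hne, hp, hp'⟩ := h
  exact ⟨F, l, p, p', r, hF, hdim, ha, hb, hne, (traversesFace_iff hHasse F p).2 hp,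
    (traversesFace_iff hHasse F p').2 hp'⟩

open Classical in
theorem reachable_induce_moveGraph (hHasse : ∀ x y : Vertex Q, O x y ↔ x ⋖ y) {u v : Vertex Q}
    (S : Finset (SaturatedChain u v)) (a b : ((S : Set (SaturatedChain u v))ᶜ : Set _))
    (h : (chainGraph (polygons Q) u v (S.image SaturatedChain.verts)).Reachable
      a.1.verts b.1.verts) :
    ((moveGraph O u v).induce (S : Set (SaturatedChain u v))ᶜ).Reachable a b := by
  have hnot : ∀ c : SaturatedChain u v, c.verts ∉ S.image SaturatedChain.verts → c ∉ S :=
    fun c hc hcS => hc (Finset.mem_image_of_mem _ hcS)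
  rw [SimpleGraph.reachable_iff_reflTransGen] at h
  suffices ∀ l, Relation.ReflTransGen
      (chainGraph (polygons Q) u v (S.image SaturatedChain.verts)).Adj a.1.verts l →
      ∃ c, c.1.verts = l ∧
        ((moveGraph O u v).induce (S : Set (SaturatedChain u v))ᶜ).Reachable a c by
    obtain ⟨c, hc, hac⟩ := this _ h
    rwa [← Subtype.ext (SaturatedChain.verts_injective u v hc)]
  intro l hl
  induction hl with
  | refl => exact ⟨a, rfl, .refl _⟩
  | @tail m l' _ hadj ih =>
    obtain ⟨c, rfl, hac⟩ := ih
    obtain ⟨hmove, -, hl', hl'S⟩ := hadj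
    let c' : SaturatedChain u v := ⟨l', hl'.1, hl'.2.1, hl'.2.2⟩
    have hc' : c' ∉ S := hnot c' hl'S
    refine ⟨⟨c', by simpa using hc'⟩, rfl, hac.trans (SimpleGraph.Adj.reachable ?_)⟩
    exact isMove_of_polygonMove (c' := c') hHasse hmove

end TwoFaces

/-- There is a saturated chain through each atom of an interval. -/
theorem numAtoms_le_card_saturatedChain {P : Type*} [PartialOrder P] [Finite P] (u v : P) :
    (numAtoms u v : ℕ∞) ≤ ENat.card (SaturatedChain u v) := by
  have h : ∀ x : {x : P | u ⋖ x ∧ x ≤ v}, ∃ l, IsSat x.1 v l := fun x => exists_isSat x.2.2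
  choose f hf using h
  have hg := fun x => (hf x).cons x.2.1
  let g : {x : P | u ⋖ x ∧ x ≤ v} → SaturatedChain u v := fun x =>
    ⟨u :: f x, (hg x).1, (hg x).2.1, (hg x).2.2⟩
  have hinj : Function.Injective g := by
    intro x y hxy
    have h1 : f x = f y := (List.cons.inj (congrArg SaturatedChain.verts hxy)).2
    have h2 := (hf x).2.1
    rw [h1, (hf y).2.1] at h2
    exact Subtype.ext (Option.some.inj h2).symm
  rw [numAtoms, Set.Finite.cast_ncard_eq (Set.toFinite _)]
  exact ENat.card_le_card_of_injective hinj

theorem theorem1p2 {d : ℕ} (Q : Set (EuclideanSpace ℝ (Fin d))) (hQ : IsPolytope Q)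
    (O : Vertex Q → Vertex Q → Prop) (hO : IsFacialOrientation Q O)
    (hsimple : IsDirectionallySimple Q O)
    -- the orientation is the Hasse diagram of a lattice on the vertex set
    [Lattice (Vertex Q)] (hHasse : ∀ x y : Vertex Q, O x y ↔ x ⋖ y)
    (u v : Vertex Q) (huv : u ≤ v) :
    (moveGraph O u v).Connected ∧
      (2 ≤ numAtoms u v → IsKConnected (moveGraph O u v) (numAtoms u v - 1)) := by
  classical
  have := hQ.finite_vertex
  have hfam := isPolygonFamily_polygons hQ hO hsimple hHasse
  have hpre : ∀ S : Finset (SaturatedChain u v), S.card ≤ numAtoms u v - 2 →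
      ((moveGraph O u v).induce (S : Set (SaturatedChain u v))ᶜ).Preconnected := by
    intro S hS a b
    have hnot : ∀ c : ((S : Set (SaturatedChain u v))ᶜ : Set _),
        c.1.verts ∉ S.image SaturatedChain.verts := fun c hc => by
      rw [(SaturatedChain.verts_injective u v).mem_finset_image] at hc
      exact c.2 hc
    refine reachable_induce_moveGraph hHasse S a b ?_
    convert hfam.chainsConnected v u _ (Finset.card_image_le.trans hS) _ _ a.1.isSat b.1.isSat
      (hnot a) (hnot b)
  obtain ⟨l, hl⟩ := exists_isSat huv
  refine ⟨?_, fun h2 => ⟨?_, fun S hS => ?_⟩⟩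
  · have : Nonempty (SaturatedChain u v) := ⟨⟨l, hl.1, hl.2.1, hl.2.2⟩⟩
    refine ⟨fun a b => ?_⟩
    have := (hpre ∅ (by simp) ⟨a, by simp⟩ ⟨b, by simp⟩).map
      (SimpleGraph.Embedding.induce _).toHom
    simpa using this
  · exact lt_of_lt_of_le (by exact_mod_cast (by omega)) (numAtoms_le_card_saturatedChain u v)
  · refine (SimpleGraph.connected_iff _).2 ⟨hpre S (by omega), ?_⟩
    by_contra hemp
    rw [not_nonempty_iff, Set.isEmpty_coe_sort, Set.compl_empty_iff] at hemp
    have hcard := numAtoms_le_card_saturatedChain u v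
    rw [← Set.encard_univ, ← hemp, Set.encard_coe_eq_coe_finsetCard] at hcard
    have : numAtoms u v ≤ S.card := by exact_mod_cast hcard
    omega
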